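/- Let $\Sigma$ be a finite alphabet, and let copy-first-half $:\Sigma^*\to\Sigma^*$ be the transduction that maps every string $w=a_0\cdots a_{n-1}$ to its first half $a_0\cdots a_{\lfloor n/2\rfloor-1}$. Then copy-first-half is computed by a B-RASP[pos] program with packed outputs; and if $|\Sigma|>1$, it is neither regular nor polyregular. Here a total function $f:\Sigma^*\to\Gamma^*$ is called - *regular* if it is defined by a deterministic finite-state two-way transducer, which reads $w$ between two end markers, starts on the left end marker, and in each step, depending on its state and the symbol under its head, writes a string and either halts or changes its state and moves its head by at most one cell; - *polyregular* if, for some $k$, it is defined by a deterministic finite-state pebble transducer with at most $k$ pebbles, that is, a two-way transducer with in addition a stack of at most $k$ positions: it can push its head position on the stack and jump to the beginning of the tape, and pop the top position and jump to it; its steps depend on the state, on the symbols at the head and at all pebbles, and on the comparisons ($<,=,>$) between all these positions. A *B-RASP[pos] program* over a finite symbol alphabet $\Delta$ is a finite sequence of definitions of vectors of length $n=|w|$, with Boolean values, values in $\Delta$, or integer values in $\{0,\dots,n-1\}$. Given are the vectors $\mathit{in}(i)=a_i$ and $\mathit{pos}(i)=i$. Each definition is either position-wise, $P(i)=e(i)$,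 or an attention operation: $P(i)=V(j_i)$, where $j_i$ is the leftmost (or the rightmost, as the definition says) $j$ with $M(i,j)$ and $S(i,j)$, and $P(i)=D(i)$ if there is no such $j$. Here $M(i,j)$ is one of $\top$, $j<i$, $j\le i$, $j>i$, $j\ge i$, and $S(i,j)$ is a Boolean expression in $i,j$ or a test $V_1(i)=V_2(j)$ of two integer vectors. Expressions are built from earlier vectors: Boolean ones with $\top,\bot$, equality of symbols, Boolean connectives, and comparisons ($=,<,\le,>,\ge$) of integer expressions that together contain at most one position variable; symbol ones with constants from $\Delta$ and "if-else"; integer ones with $0,1,+,-$, all values being clipped to $\{0,\dots,n-1\}$. The program computes $f:\Sigma^*\to\Gamma^*$ *with packed outputs* if, for some $k$, $\Delta$ contains $\Sigma$ and the set $\Gamma^{\le k}$ of strings of length at most $k$, and on every input $w$ a designated output vector has entries in $\Gamma^{\le k}$ whose concatenation is $f(w)$. -/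

import Mathlib

namespace Transduction

/-- The transduction copy-first-half: the first `⌊n/2⌋` symbols of a string of length `n`. -/
def copyFirstHalf {α : Type*} (w : List α) : List α := w.take (w.length / 2)

/-! ### Two-way and pebble transducers -/

/-- Symbols on the input tape: a letter of the input alphabet or one of the two end markers. -/
inductive TapeSymbol (α : Type*) where
  | leftEnd : TapeSymbol α
  | letter (a : α) : TapeSymbol α
  | rightEnd : TapeSymbol α

/-- The tape of `w` has the positions `0, …, |w| + 1`: the left end marker at `0`, the letters
of `w` at `1, …, |w|`, and the right end marker at `|w| + 1`. -/
def tapeSymbol {α : Type*} (w : List α) : ℕ → TapeSymbol α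
  | 0 => .leftEnd
  | p + 1 => match w[p]? with
    | some a => .letter a
    | none => .rightEnd

inductive Move where
  | left
  | stay
  | right

/-- The new head position on a tape with positions `0, …, last`; undefined if the head would
leave the tape. -/
def Move.apply (last : ℕ) : Move → ℕ → Option ℕ
  | .left, 0 => none
  | .left, p + 1 => some p
  | .stay, p => some p
  | .right, p => if p < last then some (p + 1) else none

/-- A (deterministic) two-way transducer with states `Q`, input alphabet `α`, output alphabet `β`.
In state `q` with the head on the symbol `s`, `T.step q s = (u, some (q', m))` means that it writes
`u`, moves the head by `m` and enters `q'`; `T.step q s = (u, none)` means that it writes `u`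
and halts. -/
structure TwoWayTransducer (Q α β : Type*) where
  start : Q
  step : Q → TapeSymbol α → List β × Option (Q × Move)

namespace TwoWayTransducer

/-- `T.Produces w q p v`: on the input `w`, the run of `T` from state `q` and head position `p`
halts, and the string written from there on is `v`. -/
inductive Produces {Q α β : Type*} (T : TwoWayTransducer Q α β) (w : List α) :
    Q → ℕ → List β → Prop where
  | halt {q : Q} {p : ℕ} {u : List β}
      (hstep : T.step q (tapeSymbol w p) = (u, none)) :
      Produces T w q p u
  | move {q q' : Q} {p p' : ℕ} {m : Move} {u v : List β}
      (hstep : T.step q (tapeSymbol w p) = (u, some (q', m)))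
      (hmove : m.apply (w.length + 1) p = some p')
      (hrest : Produces T w q' p' v) :
      Produces T w q p (u ++ v)

/-- `T` defines the total function `f`. -/
def Computes {Q α β : Type*} (T : TwoWayTransducer Q α β) (f : List α → List β) : Prop :=
  ∀ w, T.Produces w T.start 0 (f w)

end TwoWayTransducer

/-- A transduction is regular if it is defined by a two-way transducer with finitely many
states. -/
def IsRegular {α β : Type*} (f : List α → List β) : Prop :=
  ∃ (Q : Type) (_ : Finite Q) (T : TwoWayTransducer Q α β), T.Computes f

/-- What a pebble transducer sees when its head and pebbles are at the positions `ps`, with the head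
first, then the pebbles from the top of the stack to the bottom: all the symbols there, and how
all these positions compare with each other. -/
structure PebbleView (α : Type*) where
  symbols : List (TapeSymbol α)
  order : List (List Ordering)

def pebbleView {α : Type*} (w : List α) (ps : List ℕ) : PebbleView α where
  symbols := ps.map (tapeSymbol w)
  order := ps.map fun p => ps.map fun p' => compare p p'

inductive PebbleAction where
  | move (m : Move)
  | push
  | pop

/-- The effect of an action on head position and stack, when at most `k` pebbles may be on the
stack. Pushing puts the head position on the stack and moves the head to the
beginning of the tape; popping removes the top pebble and moves the head to its position. -/
def PebbleAction.apply (k last : ℕ) : PebbleAction → ℕ × List ℕ → Option (ℕ × List ℕ)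
  | .move m, (p, s) => (m.apply last p).map fun p' => (p', s)
  | .push, (p, s) => if s.length < k then some (0, p :: s) else none
  | .pop, (_, []) => none
  | .pop, (_, p' :: s) => some (p', s)

/-- A (deterministic) pebble transducer. Since runs are restricted to at most `k` pebbles for a
fixed `k`, only finitely many views are ever met when `α` is finite, so that
only a finite part of `step` matters. -/
structure PebbleTransducer (Q α β : Type*) where
  start : Q
  step : Q → PebbleView α → List β × Option (Q × PebbleAction)

namespace PebbleTransducer

/-- `T.Produces k w q c v`: on the input `w` and with at most `k` pebbles, the run of `T` from
state `q` with head position `c.1` and stack `c.2` halts, and the string written from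
there on is `v`. -/
inductive Produces {Q α β : Type*} (T : PebbleTransducer Q α β) (k : ℕ) (w : List α) :
    Q → ℕ × List ℕ → List β → Prop where
  | halt {q : Q} {c : ℕ × List ℕ} {u : List β}
      (hstep : T.step q (pebbleView w (c.1 :: c.2)) = (u, none)) :
      Produces T k w q c u
  | act {q q' : Q} {c c' : ℕ × List ℕ} {a : PebbleAction} {u v : List β}
      (hstep : T.step q (pebbleView w (c.1 :: c.2)) = (u, some (q', a)))
      (hact : a.apply k (w.length + 1) c = some c')
      (hrest : Produces T k w q' c' v) :
      Produces T k w q c (u ++ v)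

/-- `T` with at most `k` pebbles defines the total function `f`. -/
def Computes {Q α β : Type*} (T : PebbleTransducer Q α β) (k : ℕ)
    (f : List α → List β) : Prop :=
  ∀ w, T.Produces k w T.start (0, []) (f w)

end PebbleTransducer

/-- A transduction is polyregular if it is defined by a pebble transducer with finitely many states
and at most `k` pebbles on the stack, for some `k`. -/
def IsPolyregular {α β : Type*} (f : List α → List β) : Prop :=
  ∃ (k : ℕ) (Q : Type) (_ : Finite Q) (T : PebbleTransducer Q α β), T.Computes k f

end Transduction

/-! ### The language B-RASP[pos] -/

namespace BRASP

/-- The types of values. -/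
inductive Ty where
  | bool
  | char
  | nat

/-- Values, over the finite alphabet `Δ` of symbols. -/
abbrev Val (Δ : Type) : Ty → Type
  | .bool => Bool
  | .char => Δ
  | .nat => ℕ

/-- Names of the vectors of type `t` among those defined so far, whose types are `Γ` (the most
recent one first). -/
inductive VecName : List Ty → Ty → Type where
  | last {Γ : List Ty} {t : Ty} : VecName (t :: Γ) t
  | prev {Γ : List Ty} {s t : Ty} (x : VecName Γ t) : VecName (s :: Γ) t

/-- Contents of the vectors of length `n` defined so far. -/
abbrev Env (Δ : Type) (n : ℕ) (Γ : List Ty) : Type :=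
  ∀ t : Ty, VecName Γ t → Fin n → Val Δ t

def Env.nil {Δ : Type} {n : ℕ} : Env Δ n [] := fun _ x => nomatch x

def Env.cons {Δ : Type} {n : ℕ} {Γ : List Ty} {s : Ty} (vec : Fin n → Val Δ s)
    (env : Env Δ n Γ) : Env Δ n (s :: Γ)
  | _, .last => vec
  | _, .prev x => env _ x

/-- Integer expressions in one position variable, which is left implicit. -/
inductive NatExp (Γ : List Ty) where
  | zero
  | one
  | vec (x : VecName Γ .nat)
  | add (e₁ e₂ : NatExp Γ)
  | sub (e₁ e₂ : NatExp Γ)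

/-- Values of integer expressions at position `i`; all values are clipped to `{0, …, n - 1}`. -/
def NatExp.eval {Δ : Type} {n : ℕ} {Γ : List Ty} (env : Env Δ n Γ) (i : Fin n) :
    NatExp Γ → ℕ
  | .zero => 0
  | .one => min 1 (n - 1)
  | .vec x => env .nat x i
  | .add e₁ e₂ => min (e₁.eval env i + e₂.eval env i) (n - 1)
  | .sub e₁ e₂ => e₁.eval env i - e₂.eval env i

inductive Cmp where
  | eq
  | lt
  | le
  | gt
  | ge

def Cmp.eval : Cmp → ℕ → ℕ → Bool
  | .eq, a, b => decide (a = b)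
  | .lt, a, b => decide (a < b)
  | .le, a, b => decide (a ≤ b)
  | .gt, a, b => decide (a > b)
  | .ge, a, b => decide (a ≥ b)

/-- Expressions whose position variables are in `X`. A comparison `cmp` of integers
mentions one position variable only. -/
inductive Exp (Δ : Type) (Γ : List Ty) (X : Type) : Ty → Type where
  | tt : Exp Δ Γ X .bool
  | ff : Exp Δ Γ X .bool
  | boolVec (x : VecName Γ .bool) (i : X) : Exp Δ Γ X .bool
  | charEq (e₁ e₂ : Exp Δ Γ X .char) : Exp Δ Γ X .bool
  | and (e₁ e₂ : Exp Δ Γ X .bool) : Exp Δ Γ X .bool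
  | or (e₁ e₂ : Exp Δ Γ X .bool) : Exp Δ Γ X .bool
  | not (e : Exp Δ Γ X .bool) : Exp Δ Γ X .bool
  | cmp (i : X) (c : Cmp) (e₁ e₂ : NatExp Γ) : Exp Δ Γ X .bool
  | symbol (a : Δ) : Exp Δ Γ X .char
  | charVec (x : VecName Γ .char) (i : X) : Exp Δ Γ X .char
  | ite (b : Exp Δ Γ X .bool) (e₁ e₂ : Exp Δ Γ X .char) : Exp Δ Γ X .char
  | nat (i : X) (e : NatExp Γ) : Exp Δ Γ X .nat

open Classical in
/-- Values of expressions under the assignment `ρ` of positions to position variables. -/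
noncomputable def Exp.eval {Δ : Type} {n : ℕ} {Γ : List Ty} {X : Type} (env : Env Δ n Γ)
    (ρ : X → Fin n) : {t : Ty} → Exp Δ Γ X t → Val Δ t
  | _, .tt => true
  | _, .ff => false
  | _, .boolVec x i => env .bool x (ρ i)
  | _, .charEq e₁ e₂ => decide (e₁.eval env ρ = e₂.eval env ρ)
  | _, .and e₁ e₂ => Bool.and (e₁.eval env ρ) (e₂.eval env ρ)
  | _, .or e₁ e₂ => Bool.or (e₁.eval env ρ) (e₂.eval env ρ)
  | _, .not e => Bool.not (e.eval env ρ)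
  | _, .cmp i c e₁ e₂ => c.eval (e₁.eval env (ρ i)) (e₂.eval env (ρ i))
  | _, .symbol a => a
  | _, .charVec x i => env .char x (ρ i)
  | _, .ite b e₁ e₂ => cond (b.eval env ρ) (e₁.eval env ρ) (e₂.eval env ρ)
  | _, .nat i e => e.eval env (ρ i)

/-- The two position variables of an attention predicate `S(i, j)`. -/
inductive PairVar where
  | i
  | j

inductive Choice where
  | leftmost
  | rightmost

/-- Mask predicates `M(i, j)`: `⊤`, `j < i`, `j ≤ i`, `j > i`, `j ≥ i`. -/
inductive Mask where
  | none
  | lt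
  | le
  | gt
  | ge

def Mask.Holds {n : ℕ} : Mask → Fin n → Fin n → Prop
  | .none, _, _ => True
  | .lt, i, j => j < i
  | .le, i, j => j ≤ i
  | .gt, i, j => j > i
  | .ge, i, j => j ≥ i

/-- Attention predicates `S(i, j)`: a Boolean expression, or a test `V₁(i) = V₂(j)` for
previously defined integer vectors. -/
inductive AttnPred (Δ : Type) (Γ : List Ty) where
  | bool (e : Exp Δ Γ PairVar .bool)
  | natEq (V₁ V₂ : VecName Γ .nat)

def AttnPred.Holds {Δ : Type} {n : ℕ} {Γ : List Ty} (env : Env Δ n Γ) :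
    AttnPred Δ Γ → Fin n → Fin n → Prop
  | .bool e, i, j => e.eval env (fun | .i => i | .j => j) = true
  | .natEq V₁ V₂, i, j => env .nat V₁ i = env .nat V₂ j

/-- Right-hand sides of definitions of vectors of type `t`: position-wise operations and
attention operations. -/
inductive Rhs (Δ : Type) (Γ : List Ty) (t : Ty) where
  | pointwise (e : Exp Δ Γ Unit t)
  | attention (choice : Choice) (M : Mask) (S : AttnPred Δ Γ) (V D : Exp Δ Γ Unit t)

open Classical in
/-- The positions `j` with `M(i, j)` and `S(i, j)`. -/
noncomputable def attended {Δ : Type} {n : ℕ} {Γ : List Ty} (env : Env Δ n Γ) (M : Mask)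
    (S : AttnPred Δ Γ) (i : Fin n) : Finset (Fin n) :=
  Finset.univ.filter fun j => M.Holds i j ∧ S.Holds env i j

noncomputable def Choice.pick {n : ℕ} (s : Finset (Fin n)) (hs : s.Nonempty) :
    Choice → Fin n
  | .leftmost => s.min' hs
  | .rightmost => s.max' hs

open Classical in
noncomputable def Rhs.eval {Δ : Type} {n : ℕ} {Γ : List Ty} {t : Ty} (env : Env Δ n Γ) :
    Rhs Δ Γ t → Fin n → Val Δ t
  | .pointwise e, i => e.eval env fun _ => i
  | .attention choice M S V D, i =>
      if h : (attended env M S i).Nonempty then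
        V.eval env fun _ => choice.pick (attended env M S i) h
      else D.eval env fun _ => i

/-- Programs that can refer to vectors of the types `Γ`: a sequence of definitions, then the choice
of the output vector. -/
inductive Program (Δ : Type) : List Ty → Type where
  | out {Γ : List Ty} (x : VecName Γ .char) : Program Δ Γ
  | define {Γ : List Ty} {t : Ty} (r : Rhs Δ Γ t) (P : Program Δ (t :: Γ)) : Program Δ Γ

/-- The contents of the output vector. -/
noncomputable def Program.eval {Δ : Type} {n : ℕ} : {Γ : List Ty} → Program Δ Γ → Env Δ n Γ →
    Fin n → Δ
  | _, .out x, env => env .char x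
  | _, .define r P, env => P.eval (env.cons (r.eval env))

/-- The predefined vectors: the input `in`, and `pos` with `pos(i) = i`. -/
def initialEnv {Δ : Type} {n : ℕ} (input : Fin n → Δ) : Env Δ n [.char, .nat] :=
  Env.cons (s := .char) input (Env.cons (s := .nat) (fun i => (i : ℕ)) Env.nil)

/-- Strings of length at most `k`, the symbols of packed outputs. -/
abbrev Packed (β : Type*) (k : ℕ) : Type _ := {u : List β // u.length ≤ k}

/-- `f` is computed by a B-RASP[pos] program with packed outputs: for some `k`, a finite alphabet
`Δ` containing (through `inSym` and `outSym`) the input alphabet `α` and the set of strings of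
length at most `k` over `β`, and a program over `Δ`, the output vector on each input `w`
consists of packed symbols whose concatenation is `f w`. -/
def Computable {α β : Type*} (f : List α → List β) : Prop :=
  ∃ (k : ℕ) (Δ : Type) (_ : Finite Δ) (inSym : α ↪ Δ) (outSym : Packed β k ↪ Δ)
    (P : Program Δ [.char, .nat]),
    ∀ w : List α, ∃ u : Fin w.length → Packed β k,
      P.eval (initialEnv fun i => inSym (w.get i)) = (fun i => outSym (u i)) ∧
        (List.ofFn fun i => (u i).val).flatten = f w

end BRASP

/-! Computability: position `i` lies in the first half iff `2 i < n - 1`. Attention to the rightmost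
position supplies `n - 1`, and clipping the sum at `n - 1` does not change this comparison.

Non-polyregularity: if `f` is polyregular, then for each letter `b` the language of all `w` with `b
∈ f w` has finitely many Nerode classes. For copy-first-half and `w = a^m b a^p` with `a ≠ b`,
membership means `m + 1 ≤ p`, so the prefixes `a^m` are pairwise inequivalent
(`not_isPolyregular_copyFirstHalf`). Regular functions are polyregular, with no pebbles.

The Nerode classes are counted as in the translation of monadic second-order logic into automata.
`FiniteIndex` is closed under Boolean connectives and under quantification over positions and
labellings, hence under least fixed points of reachability (`FiniteIndex.leastFixedPoint`). Whether
a run writes `b` is such a fixed point, nested once per available pebble: between a push and its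
matching pop only the entered state and the writing of `b` matter (`finiteIndex_outcome`,
`Computes.mem_iff`). -/

namespace Transduction

/-! ### Functions of labelled positions with finite Nerode index -/

/-- The labelling that agrees with `X` on `0, …, n - 1` and continues with `Z` from `n` on. -/
def glue {B : Type*} (n : ℕ) (X Z : ℕ → B) (i : ℕ) : B := if i < n then X i else Z (i - n)

/-- The assignment of positions that follows `e` where `e` is defined, and places the other variables
according to `r`, counted from `n` on. -/
def joinAssign (n : ℕ) (e : ℕ → Option ℕ) (r : ℕ → ℕ) (v : ℕ) : ℕ := (e v).getD (n + r v)

/-- A function of a labelling `X` of the positions `0, …, n - 1` and an assignment of positions to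
variables has finite index if it sees only a finite amount of information about each prefix. -/
def FiniteIndex {B Y : Type*} (Φ : ℕ → (ℕ → B) → (ℕ → ℕ) → Y) : Prop :=
  ∃ (S : Type) (_ : Finite S) (τ : ℕ → (ℕ → B) → (ℕ → Option ℕ) → S),
    ∀ n n' X X' e e', (∀ v, ∀ p ∈ e v, p < n) → (∀ v, ∀ p ∈ e' v, p < n') →
      τ n X e = τ n' X' e' → ∀ m Z r,
        Φ (n + m) (glue n X Z) (joinAssign n e r) = Φ (n' + m) (glue n' X' Z) (joinAssign n' e' r)

section Basic

variable {B C Y Y' Y'' : Type*}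

theorem glue_of_lt {n i : ℕ} (X Z : ℕ → B) (h : i < n) : glue n X Z i = X i := if_pos h

theorem glue_add (n i : ℕ) (X Z : ℕ → B) : glue n X Z (n + i) = Z i := by simp [glue]

theorem glue_shift (n : ℕ) (X : ℕ → B) : glue n X (fun i => X (n + i)) = X := by
  funext i
  unfold glue
  split_ifs with h
  · rfl
  · exact congrArg X (by omega)

theorem comp_glue (g : B → C) (n : ℕ) (X Z : ℕ → B) :
    (fun i => g (glue n X Z i)) = glue n (fun i => g (X i)) (fun i => g (Z i)) := by
  funext i
  unfold glue
  split_ifs <;> rfl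

theorem pair_glue (n : ℕ) (X Z : ℕ → B) (V W : ℕ → C) :
    (fun i => (glue n X Z i, glue n V W i)) =
      glue n (fun i => (X i, V i)) (fun i => (Z i, W i)) := by
  funext i
  unfold glue
  split_ifs <;> rfl

theorem joinAssign_some {n v p : ℕ} {e : ℕ → Option ℕ} (r : ℕ → ℕ) (h : e v = some p) :
    joinAssign n e r v = p := by simp [joinAssign, h]

theorem joinAssign_none {n v : ℕ} {e : ℕ → Option ℕ} (r : ℕ → ℕ) (h : e v = none) :
    joinAssign n e r v = n + r v := by simp [joinAssign, h]

theorem update_joinAssign_left (n v p : ℕ) (e : ℕ → Option ℕ) (r : ℕ → ℕ) :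
    Function.update (joinAssign n e r) v p = joinAssign n (Function.update e v (some p)) r := by
  funext x
  by_cases h : x = v
  · subst h; simp [joinAssign]
  · simp [joinAssign, h]

theorem update_joinAssign_right (n v p : ℕ) (e : ℕ → Option ℕ) (r : ℕ → ℕ) :
    Function.update (joinAssign n e r) v (n + p) =
      joinAssign n (Function.update e v none) (Function.update r v p) := by
  funext x
  by_cases h : x = v
  · subst h; simp [joinAssign]
  · simp [joinAssign, h]

theorem update_some_lt {n v p : ℕ} {e : ℕ → Option ℕ} (he : ∀ v, ∀ p ∈ e v, p < n) (hp : p < n) :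
    ∀ x, ∀ y ∈ Function.update e v (some p) x, y < n := by
  intro x y hy
  by_cases h : x = v
  · subst h; simp at hy; omega
  · rw [Function.update_of_ne h] at hy; exact he x y hy

theorem update_none_lt {n v : ℕ} {e : ℕ → Option ℕ} (he : ∀ v, ∀ p ∈ e v, p < n) :
    ∀ x, ∀ y ∈ Function.update e v none x, y < n := by
  intro x y hy
  by_cases h : x = v
  · subst h; simp at hy
  · rw [Function.update_of_ne h] at hy; exact he x y hy

/-! ### Closure of finite index under monadic second-order constructions -/

namespace FiniteIndex

theorem const (y : Y) : FiniteIndex (fun (_ : ℕ) (_ : ℕ → B) (_ : ℕ → ℕ) => y) :=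
  ⟨Unit, inferInstance, fun _ _ _ => (), fun _ _ _ _ _ _ _ _ _ _ _ _ => rfl⟩

theorem map {Φ : ℕ → (ℕ → B) → (ℕ → ℕ) → Y} (hΦ : FiniteIndex Φ) (h : Y → Y') :
    FiniteIndex fun n X e => h (Φ n X e) := by
  obtain ⟨S, hS, τ, hτ⟩ := hΦ
  exact ⟨S, hS, τ, fun n n' X X' e e' he he' ht m Z r =>
    congrArg h (hτ n n' X X' e e' he he' ht m Z r)⟩

theorem map₂ {Φ : ℕ → (ℕ → B) → (ℕ → ℕ) → Y} {Ψ : ℕ → (ℕ → B) → (ℕ → ℕ) → Y'}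
    (hΦ : FiniteIndex Φ) (hΨ : FiniteIndex Ψ) (h : Y → Y' → Y'') :
    FiniteIndex fun n X e => h (Φ n X e) (Ψ n X e) := by
  obtain ⟨S, hS, τ, hτ⟩ := hΦ
  obtain ⟨S', hS', τ', hτ'⟩ := hΨ
  refine ⟨S × S', inferInstance, fun n X e => (τ n X e, τ' n X e), ?_⟩
  intro n n' X X' e e' he he' ht m Z r
  obtain ⟨h1, h2⟩ := Prod.mk.inj ht
  beta_reduce
  rw [hτ n n' X X' e e' he he' h1, hτ' n n' X X' e e' he he' h2]

theorem pi {ι : Type} [Finite ι] {Φ : ι → ℕ → (ℕ → B) → (ℕ → ℕ) → Y}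
    (hΦ : ∀ i, FiniteIndex (Φ i)) : FiniteIndex fun n X e i => Φ i n X e := by
  choose S hS τ hτ using hΦ
  refine ⟨∀ i, S i, inferInstance, fun n X e i => τ i n X e, ?_⟩
  intro n n' X X' e e' he he' ht m Z r
  funext i
  exact hτ i n n' X X' e e' he he' (congrFun ht i) m Z r

theorem exists_finite {ι : Type} [Finite ι] {Φ : ι → ℕ → (ℕ → B) → (ℕ → ℕ) → Prop}
    (hΦ : ∀ i, FiniteIndex (Φ i)) : FiniteIndex fun n X e => ∃ i, Φ i n X e :=
  (pi hΦ).map fun P => ∃ i, P i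

theorem forall_finite {ι : Type} [Finite ι] {Φ : ι → ℕ → (ℕ → B) → (ℕ → ℕ) → Prop}
    (hΦ : ∀ i, FiniteIndex (Φ i)) : FiniteIndex fun n X e => ∀ i, Φ i n X e :=
  (pi hΦ).map fun P => ∀ i, P i

theorem and {Φ Ψ : ℕ → (ℕ → B) → (ℕ → ℕ) → Prop} (hΦ : FiniteIndex Φ) (hΨ : FiniteIndex Ψ) :
    FiniteIndex fun n X e => Φ n X e ∧ Ψ n X e := hΦ.map₂ hΨ _

theorem or {Φ Ψ : ℕ → (ℕ → B) → (ℕ → ℕ) → Prop} (hΦ : FiniteIndex Φ) (hΨ : FiniteIndex Ψ) :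
    FiniteIndex fun n X e => Φ n X e ∨ Ψ n X e := hΦ.map₂ hΨ _

theorem imp {Φ Ψ : ℕ → (ℕ → B) → (ℕ → ℕ) → Prop} (hΦ : FiniteIndex Φ) (hΨ : FiniteIndex Ψ) :
    FiniteIndex fun n X e => Φ n X e → Ψ n X e := hΦ.map₂ hΨ fun P Q => P → Q

theorem not {Φ : ℕ → (ℕ → B) → (ℕ → ℕ) → Prop} (hΦ : FiniteIndex Φ) :
    FiniteIndex fun n X e => ¬ Φ n X e := hΦ.map _

theorem listMap {ι : Type*} {Φ : ι → ℕ → (ℕ → B) → (ℕ → ℕ) → Y}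
    (hΦ : ∀ i, FiniteIndex (Φ i)) (l : List ι) :
    FiniteIndex fun n X e => l.map fun i => Φ i n X e := by
  induction l with
  | nil => exact const []
  | cons i l ih => exact (hΦ i).map₂ ih List.cons

theorem relabel {Φ : ℕ → (ℕ → C) → (ℕ → ℕ) → Y} (hΦ : FiniteIndex Φ) (g : B → C) :
    FiniteIndex fun n X e => Φ n (fun i => g (X i)) e := by
  obtain ⟨S, hS, τ, hτ⟩ := hΦ
  refine ⟨S, hS, fun n X e => τ n (fun i => g (X i)) e, ?_⟩
  intro n n' X X' e e' he he' ht m Z r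
  simp only [comp_glue]
  exact hτ _ _ _ _ _ _ he he' ht _ _ _

/-- Quantification over labellings. -/
theorem exists_labelling {Φ : ℕ → (ℕ → B × C) → (ℕ → ℕ) → Prop} (hΦ : FiniteIndex Φ) :
    FiniteIndex fun n X e => ∃ V : ℕ → C, Φ n (fun i => (X i, V i)) e := by
  obtain ⟨S, hS, τ, hτ⟩ := hΦ
  -- Subset construction: record all types that some labelling of the prefix can produce. A witness
  -- is transferred by exchanging its prefix and keeping its suffix.
  refine ⟨Set S, inferInstance, fun n X e => {s | ∃ V : ℕ → C, τ n (fun i => (X i, V i)) e = s}, ?_⟩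
  have key : ∀ n n' X X' e e', (∀ v, ∀ p ∈ e v, p < n) → (∀ v, ∀ p ∈ e' v, p < n') →
      {s | ∃ V : ℕ → C, τ n (fun i => (X i, V i)) e = s} =
        {s | ∃ V : ℕ → C, τ n' (fun i => (X' i, V i)) e' = s} →
      ∀ m Z r, (∃ V : ℕ → C, Φ (n + m) (fun i => (glue n X Z i, V i)) (joinAssign n e r)) →
        ∃ V : ℕ → C, Φ (n' + m) (fun i => (glue n' X' Z i, V i)) (joinAssign n' e' r) := by
    rintro n n' X X' e e' he he' ht m Z r ⟨V, hV⟩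
    obtain ⟨V', hV'⟩ := (Set.ext_iff.1 ht _).1 ⟨V, rfl⟩
    refine ⟨glue n' V' fun i => V (n + i), ?_⟩
    rw [pair_glue, hτ _ _ _ _ _ _ he' he hV', ← pair_glue, glue_shift]
    exact hV
  intro n n' X X' e e' he he' ht m Z r
  exact propext ⟨key _ _ _ _ _ _ he he' ht m Z r, key _ _ _ _ _ _ he' he ht.symm m Z r⟩

/-- Quantification over positions. -/
theorem exists_position {Φ : ℕ → (ℕ → B) → (ℕ → ℕ) → Prop} (hΦ : FiniteIndex Φ) (v : ℕ) :
    FiniteIndex fun n X e => ∃ p < n, Φ n X (Function.update e v p) := by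
  obtain ⟨S, hS, τ, hτ⟩ := hΦ
  -- The set covers witnesses inside the prefix; the second component, with `v` unplaced, covers
  -- witnesses in the suffix.
  refine ⟨Set S × S, inferInstance, fun n X e =>
    ({s | ∃ p < n, τ n X (Function.update e v (some p)) = s}, τ n X (Function.update e v none)), ?_⟩
  have key : ∀ n n' X X' e e', (∀ v, ∀ p ∈ e v, p < n) → (∀ v, ∀ p ∈ e' v, p < n') →
      {s | ∃ p < n, τ n X (Function.update e v (some p)) = s} =
        {s | ∃ p < n', τ n' X' (Function.update e' v (some p)) = s} →
      τ n X (Function.update e v none) = τ n' X' (Function.update e' v none) →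
      ∀ m Z r, (∃ p < n + m, Φ (n + m) (glue n X Z) (Function.update (joinAssign n e r) v p)) →
        ∃ p < n' + m, Φ (n' + m) (glue n' X' Z) (Function.update (joinAssign n' e' r) v p) := by
    rintro n n' X X' e e' he he' ht ht' m Z r ⟨p, hp, h⟩
    rcases lt_or_ge p n with hpn | hpn
    · obtain ⟨p', hp', h'⟩ := (Set.ext_iff.1 ht _).1 ⟨p, hpn, rfl⟩
      refine ⟨p', by omega, ?_⟩
      rw [update_joinAssign_left] at h ⊢
      rwa [hτ _ _ _ _ _ _ (update_some_lt he' hp') (update_some_lt he hpn) h']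
    · obtain ⟨j, rfl⟩ := Nat.exists_eq_add_of_le hpn
      refine ⟨n' + j, by omega, ?_⟩
      rw [update_joinAssign_right] at h ⊢
      rwa [← hτ _ _ _ _ _ _ (update_none_lt he) (update_none_lt he') ht']
  intro n n' X X' e e' he he' ht m Z r
  obtain ⟨h1, h2⟩ := Prod.mk.inj ht
  exact propext ⟨key _ _ _ _ _ _ he he' h1 h2 m Z r,
    key _ _ _ _ _ _ he' he h1.symm h2.symm m Z r⟩

theorem forall_position {Φ : ℕ → (ℕ → B) → (ℕ → ℕ) → Prop} (hΦ : FiniteIndex Φ) (v : ℕ) :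
    FiniteIndex fun n X e => ∀ p < n, Φ n X (Function.update e v p) := by
  have := (hΦ.not.exists_position v).not
  simpa only [not_exists, not_and, not_not] using this

theorem update_zero {Φ : ℕ → (ℕ → B) → (ℕ → ℕ) → Y} (hΦ : FiniteIndex Φ) (v : ℕ) :
    FiniteIndex fun n X e => Φ n X (Function.update e v 0) := by
  obtain ⟨S, hS, τ, hτ⟩ := hΦ
  -- Position `0` belongs to the suffix exactly when the prefix is empty, so the type must record
  -- whether `n = 0`.
  refine ⟨Prop × S, inferInstance, fun n X e =>
    (n = 0, τ n X (Function.update e v (if n = 0 then none else some 0))), ?_⟩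
  intro n n' X X' e e' he he' ht m Z r
  obtain ⟨h1, h2⟩ := Prod.mk.inj ht
  by_cases hn : n = 0
  · have hn' : n' = 0 := h1.mp hn
    simp only [hn, hn', if_true] at h2
    have := hτ _ _ _ _ _ _ (update_none_lt (v := v) (hn ▸ he)) (update_none_lt (v := v) (hn' ▸ he'))
      h2 m Z (Function.update r v 0)
    rw [← update_joinAssign_right, ← update_joinAssign_right] at this
    rw [hn, hn']
    exact this
  · have hn' : n' ≠ 0 := fun h => hn (h1.mpr h)
    beta_reduce
    simp only [hn, hn', if_false] at h2
    rw [update_joinAssign_left, update_joinAssign_left]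
    exact hτ _ _ _ _ _ _ (update_some_lt he (by omega)) (update_some_lt he' (by omega)) h2 _ _ _

theorem label [Finite Y] (h : B → Y) (v : ℕ) :
    FiniteIndex fun (_ : ℕ) (X : ℕ → B) (e : ℕ → ℕ) => h (X (e v)) := by
  -- Types must live in `Type`, so the values are renamed by `Fin N`; `none` marks a variable placed
  -- in the suffix.
  obtain ⟨N, ⟨f⟩⟩ := Finite.exists_equiv_fin Y
  refine ⟨Option (Fin N), inferInstance, fun _ X e => (e v).map fun p => f (h (X p)), ?_⟩
  intro n n' X X' e e' he he' ht m Z r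
  rcases h1 : e v with _ | p <;> rcases h2 : e' v with _ | p' <;> simp [h1, h2] at ht <;> beta_reduce
  · rw [joinAssign_none r h1, joinAssign_none r h2, glue_add, glue_add]
  · rw [joinAssign_some r h1, joinAssign_some r h2, glue_of_lt _ _ (he v p h1),
      glue_of_lt _ _ (he' v p' h2), ht]

/-- Every prefix position precedes every suffix position, and between two suffix positions the
offset `n` cancels; only the order inside the prefix has to be stored. -/
theorem compare (u v : ℕ) :
    FiniteIndex fun (_ : ℕ) (_ : ℕ → B) (e : ℕ → ℕ) => Ord.compare (e u) (e v) := by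
  refine ⟨Bool × Bool × Ordering, inferInstance, fun _ _ e =>
    ((e u).isSome, (e v).isSome, Ord.compare ((e u).getD 0) ((e v).getD 0)), ?_⟩
  intro n n' X X' e e' he he' ht m Z r
  rcases h1 : e u with _ | p <;> rcases h2 : e' u with _ | p' <;> rcases h3 : e v with _ | q <;>
    rcases h4 : e' v with _ | q' <;> simp [h1, h2, h3, h4] at ht <;>
    simp only [joinAssign, h1, h2, h3, h4, Option.getD_none, Option.getD_some]
  · simp [Nat.compare_eq_ite_lt]
  · rw [Nat.compare_eq_gt.2, Nat.compare_eq_gt.2]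
    · have := he' v q' h4; omega
    · have := he v q h3; omega
  · rw [Nat.compare_eq_lt.2, Nat.compare_eq_lt.2]
    · have := he' u p' h2; omega
    · have := he u p h1; omega
  · exact ht

theorem eq (u v : ℕ) : FiniteIndex fun (_ : ℕ) (_ : ℕ → B) (e : ℕ → ℕ) => e u = e v := by
  have := (compare (B := B) u v).map fun o => o = Ordering.eq
  simpa only [Nat.compare_eq_eq] using this

theorem succ (u v : ℕ) : FiniteIndex fun (_ : ℕ) (_ : ℕ → B) (e : ℕ → ℕ) => e u + 1 = e v := by
  -- The last component serves a step across the cut, from the last prefix position to the first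
  -- suffix position.
  refine ⟨Bool × Bool × Prop × Prop, inferInstance, fun n _ e =>
    ((e u).isSome, (e v).isSome, (e u).getD 0 + 1 = (e v).getD 0, (e u).getD 0 + 1 = n), ?_⟩
  intro n n' X X' e e' he he' ht m Z r
  rcases h1 : e u with _ | p <;> rcases h2 : e' u with _ | p' <;> rcases h3 : e v with _ | q <;>
    rcases h4 : e' v with _ | q' <;> simp [h1, h2, h3, h4] at ht <;>
    simp only [joinAssign, h1, h2, h3, h4, Option.getD_none, Option.getD_some, eq_iff_iff]
  · omega
  · have := he' v q' h4
    have := he v q h3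
    omega
  · have := he' u p' h2
    have := he u p h1
    omega
  · exact ht.1

/-- Least fixed points: backward reachability of `base` along `edge`. -/
theorem leastFixedPoint {Q : Type} [Finite Q] {base : Q → ℕ → (ℕ → B) → (ℕ → ℕ) → Prop}
    {edge : Q → Q → ℕ → (ℕ → B) → (ℕ → ℕ) → Prop} (hb : ∀ q, FiniteIndex (base q))
    (he : ∀ q q', FiniteIndex (edge q q')) {u v : ℕ} (huv : u ≠ v)
    (q₀ : Q) :
    FiniteIndex fun n X e => ∀ V : ℕ → Q → Prop,
      (∀ p < n, ∀ q, base q n X (Function.update e u p) → V p q) →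
      (∀ p < n, ∀ p' < n, ∀ q q',
        edge q q' n X (Function.update (Function.update e u p) v p') → V p' q' → V p q) →
      V (e u) q₀ := by
  -- The unknown set `V` becomes a second label in `Q → Prop` at each position, so that the
  -- quantifier over `V` is one over labellings.
  have label' (w : ℕ) (q : Q) :
      FiniteIndex fun (_ : ℕ) (X : ℕ → B × (Q → Prop)) (e : ℕ → ℕ) => (X (e w)).2 q :=
    label (fun b : B × (Q → Prop) => b.2 q) w
  have h1 := (forall_finite fun q =>
    ((hb q).relabel (Prod.fst : B × (Q → Prop) → B)).imp (label' u q)).forall_position u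
  have h2 := ((forall_finite fun q => forall_finite fun q' =>
    ((he q q').relabel (Prod.fst : B × (Q → Prop) → B)).imp
      ((label' v q').imp (label' u q))).forall_position v).forall_position u
  have h3 := (h1.imp (h2.imp (label' u q₀))).not.exists_labelling.not
  simpa only [not_exists, not_not, Function.update_self, Function.update_of_ne huv] using h3

end FiniteIndex
end Basic
end Transduction

namespace Transduction

/-! ### Pebble transducers see only a finite amount of information about a prefix -/

instance {α : Type*} [Finite α] : Finite (TapeSymbol α) :=
  Finite.of_injective (β := Option (Option α))
    (fun | .leftEnd => none | .rightEnd => some none | .letter a => some (some a)) <| by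
    rintro (_ | a | _) (_ | a' | _) h <;> simp_all

/-- The step of the head from `p` to `p'`, without the restriction to the tape. -/
def Move.Rel : Move → ℕ → ℕ → Prop
  | .left, p, p' => p' + 1 = p
  | .stay, p, p' => p = p'
  | .right, p, p' => p + 1 = p'

theorem Move.rel_of_apply {m : Move} {last p p' : ℕ} (h : m.apply last p = some p') :
    m.Rel p p' := by
  cases m with
  | left => cases p <;> simp_all [Move.apply, Move.Rel]
  | stay => simpa [Move.apply, Move.Rel] using h
  | right => simp only [Move.apply] at h; split_ifs at h; simpa [Move.Rel] using h

theorem Move.le_of_apply {m : Move} {last p p' : ℕ} (h : m.apply last p = some p')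
    (hp : p ≤ last) : p' ≤ last := by
  cases m with
  | left => cases p <;> simp [Move.apply] at h; omega
  | stay => simp [Move.apply] at h; omega
  | right => simp only [Move.apply] at h; split_ifs at h; simp at h; omega

theorem Move.Rel.unique {m : Move} {p p' p'' : ℕ} (h : m.Rel p p') (h' : m.Rel p p'') :
    p' = p'' := by
  cases m <;> simp only [Move.Rel] at h h' <;> omega

/-- The view of the positions `ps` on a tape with labels `X`. -/
def labelView {α : Type*} (X : ℕ → TapeSymbol α) (ps : List ℕ) : PebbleView α where
  symbols := ps.map X
  order := ps.map fun p => ps.map fun p' => compare p p'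

/-- The stack with the pebbles `e (l - 1), …, e 0`, from top to bottom. -/
def stackOf (l : ℕ) (e : ℕ → ℕ) : List ℕ := (List.range l).reverse.map e

theorem stackOf_succ (l : ℕ) (e : ℕ → ℕ) : stackOf (l + 1) e = e l :: stackOf l e := by
  simp [stackOf, List.range_succ]

theorem stackOf_update {l v : ℕ} (h : l ≤ v) (e : ℕ → ℕ) (p : ℕ) :
    stackOf l (Function.update e v p) = stackOf l e := by
  unfold stackOf
  refine List.map_congr_left fun i hi => Function.update_of_ne ?_ _ _
  simp at hi
  omega

namespace PebbleTransducer

variable {Q : Type} {α β : Type*} (T : PebbleTransducer Q α β) (b : β)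

section Outcome

variable (n : ℕ) (X : ℕ → TapeSymbol α) (sub : Q → ℕ → Option Q → Prop) (s : List ℕ)

/-- The next steps from state `q` and head position `p` above the stack `s` lead to the outcome `ρ`
at once: `none` if `b` is written, `some q'` if the top of `s` is popped and `q'` is entered.
`sub q' p` are the outcomes of the run that starts after pushing `p` and entering `q'`. -/
def Immediate (ρ : Option Q) (q : Q) (p : ℕ) : Prop :=
  (b ∈ (T.step q (labelView X (p :: s))).1 ∧ ρ = none) ∨
    (∃ q', (T.step q (labelView X (p :: s))).2 = some (q', .pop) ∧ ρ = some q') ∨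
    (ρ = none ∧ ∃ q', (T.step q (labelView X (p :: s))).2 = some (q', .push) ∧ sub q' p none)

/-- The transition from `(q, p)` to `(q', p')` above the stack `s`: a move, or a push together with
all steps until the pebble is popped again. -/
def Successor (q q' : Q) (p p' : ℕ) : Prop :=
  (∃ m : Move, (T.step q (labelView X (p :: s))).2 = some (q', .move m) ∧ m.Rel p p') ∨
    (p = p' ∧ ∃ q₁, (T.step q (labelView X (p :: s))).2 = some (q₁, .push) ∧ sub q₁ p (some q'))

/-- The outcome `ρ` is reached from `(q, p)` above the stack `s`. -/
def Reach (ρ : Option Q) (q : Q) (p : ℕ) : Prop :=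
  ∀ V : ℕ → Q → Prop, (∀ p < n, ∀ q, T.Immediate b X sub s ρ q p → V p q) →
    (∀ p < n, ∀ p' < n, ∀ q q', T.Successor X sub s q q' p p' → V p' q' → V p q) → V p q

/-- The outcome `ρ` is reached from `(q, p)` above the stack `s` using at most `r` more pebbles. -/
def Outcome (n : ℕ) (X : ℕ → TapeSymbol α) : ℕ → List ℕ → Option Q → Q → ℕ → Prop
  | 0, s => T.Reach b n X (fun _ _ _ => False) s
  | r + 1, s => T.Reach b n X (fun q p ρ => Outcome n X r (p :: s) ρ q 0) s

variable {T b n X sub s}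

theorem Reach.of_immediate {ρ : Option Q} {q : Q} {p : ℕ} (hp : p < n)
    (h : T.Immediate b X sub s ρ q p) : T.Reach b n X sub s ρ q p :=
  fun _ hi _ => hi p hp q h

theorem Reach.of_successor {ρ : Option Q} {q q' : Q} {p p' : ℕ} (hp : p < n) (hp' : p' < n)
    (h : T.Successor X sub s q q' p p') (h' : T.Reach b n X sub s ρ q' p') :
    T.Reach b n X sub s ρ q p :=
  fun V hi hs => hs p hp p' hp' q q' h (h' V hi hs)

end Outcome

theorem finiteIndex_rel (m : Move) (u v : ℕ) :
    FiniteIndex fun (_ : ℕ) (_ : ℕ → TapeSymbol α) (e : ℕ → ℕ) => m.Rel (e u) (e v) := by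
  cases m with
  | left => exact FiniteIndex.succ v u
  | stay => exact FiniteIndex.eq u v
  | right => exact FiniteIndex.succ u v

/-! ### Outcomes of runs have finite index -/

section Index

variable [Finite α]

/-- Convention from here on: variables `0, …, l - 1` are the pebbles, `l` is the head, and `l + 1`
is the head after a transition. -/
theorem finiteIndex_step (q : Q) (l : ℕ) :
    FiniteIndex fun (_ : ℕ) (X : ℕ → TapeSymbol α) (e : ℕ → ℕ) =>
      T.step q (labelView X (e l :: stackOf l e)) := by
  have h1 := FiniteIndex.listMap
    (fun i => FiniteIndex.label (fun b : TapeSymbol α => b) i) (List.range (l + 1)).reverse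
  have h2 := FiniteIndex.listMap (fun i => FiniteIndex.listMap
    (fun j => FiniteIndex.compare (B := TapeSymbol α) i j) (List.range (l + 1)).reverse)
    (List.range (l + 1)).reverse
  have h3 := (h1.map₂ h2 PebbleView.mk).map (T.step q)
  simp only [← stackOf_succ]
  simpa only [labelView, stackOf, List.map_map, Function.comp_def] using h3

variable {sub : ℕ → (ℕ → TapeSymbol α) → List ℕ → Q → ℕ → Option Q → Prop}

theorem finiteIndex_immediate [Finite Q] (l : ℕ)
    (hsub : ∀ q ρ, FiniteIndex fun n X e => sub n X (stackOf l e) q (e l) ρ) (ρ : Option Q) (q : Q) :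
    FiniteIndex fun n X e => T.Immediate b X (sub n X (stackOf l e)) (stackOf l e) ρ q (e l) := by
  have hs := T.finiteIndex_step q l
  exact (hs.map fun o => b ∈ o.1 ∧ ρ = none).or
    ((hs.map fun o => ∃ q', o.2 = some (q', .pop) ∧ ρ = some q').or
    ((FiniteIndex.const (ρ = none)).and (FiniteIndex.exists_finite fun q' =>
      (hs.map fun o => o.2 = some (q', .push)).and (hsub q' none))))

theorem finiteIndex_successor [Finite Q] (l : ℕ)
    (hsub : ∀ q ρ, FiniteIndex fun n X e => sub n X (stackOf l e) q (e l) ρ) (q q' : Q) :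
    FiniteIndex fun n X e =>
      T.Successor X (sub n X (stackOf l e)) (stackOf l e) q q' (e l) (e (l + 1)) := by
  have hs := T.finiteIndex_step q l
  have : Finite Move := Finite.of_surjective
    (fun i : Fin 3 => match i with | 0 => Move.left | 1 => Move.stay | 2 => Move.right)
    fun m => by cases m; exacts [⟨0, rfl⟩, ⟨1, rfl⟩, ⟨2, rfl⟩]
  exact (FiniteIndex.exists_finite fun m : Move =>
    (hs.map fun o => o.2 = some (q', .move m)).and (finiteIndex_rel m l (l + 1))).or
    ((FiniteIndex.eq l (l + 1)).and (FiniteIndex.exists_finite fun q₁ =>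
      (hs.map fun o => o.2 = some (q₁, .push)).and (hsub q₁ (some q'))))

theorem finiteIndex_reach [Finite Q] (l : ℕ)
    (hsub : ∀ q ρ, FiniteIndex fun n X e => sub n X (stackOf l e) q (e l) ρ) (ρ : Option Q) (q : Q) :
    FiniteIndex fun n X e => T.Reach b n X (sub n X (stackOf l e)) (stackOf l e) ρ q (e l) := by
  have h := FiniteIndex.leastFixedPoint (T.finiteIndex_immediate b l hsub ρ)
    (T.finiteIndex_successor l hsub) (Nat.succ_ne_self l).symm q
  simp only [stackOf_update le_rfl, stackOf_update (Nat.le_succ l), Function.update_self,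
    Function.update_of_ne (Nat.succ_ne_self l).symm] at h
  exact h

theorem finiteIndex_outcome [Finite Q] (r l : ℕ) (ρ : Option Q) (q : Q) :
    FiniteIndex fun n X e => T.Outcome b n X r (stackOf l e) ρ q (e l) := by
  induction r generalizing l ρ q with
  | zero =>
    exact T.finiteIndex_reach b (sub := fun _ _ _ _ _ _ => False) l
      (fun _ _ => FiniteIndex.const False) ρ q
  | succ r ih =>
    refine T.finiteIndex_reach b
      (sub := fun n X s q p ρ => T.Outcome b n X r (p :: s) ρ q 0) l (fun q' ρ' => ?_) ρ q
    -- After a push, variable `l` is the top pebble and the new head `l + 1` stands at the beginning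
    -- of the tape.
    have h := (ih (l + 1) ρ' q').update_zero (l + 1)
    simpa only [stackOf_update le_rfl, Function.update_self, stackOf_succ] using h

end Index

/-! ### Outcomes describe halting runs -/

section Correct

variable {T b} {k : ℕ} {w : List α}

theorem Produces.subset {q : Q} {c : ℕ × List ℕ} {v : List β} (h : T.Produces k w q c v) :
    (T.step q (labelView (tapeSymbol w) (c.1 :: c.2))).1 ⊆ v := by
  cases h with
  | halt hstep => exact fun x hx => (congrArg (x ∈ Prod.fst ·) hstep).mp hx
  | act hstep => exact fun x hx => List.mem_append_left _ ((congrArg (x ∈ Prod.fst ·) hstep).mp hx)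

/-- This is where determinism enters: a halting run can only continue as `T.step` prescribes. -/
theorem Produces.next {q q' : Q} {c : ℕ × List ℕ} {v : List β} {a : PebbleAction}
    (h : T.Produces k w q c v)
    (hs : (T.step q (labelView (tapeSymbol w) (c.1 :: c.2))).2 = some (q', a)) :
    ∃ c' v', a.apply k (w.length + 1) c = some c' ∧ T.Produces k w q' c' v' ∧ v' ⊆ v := by
  cases h with
  | halt hstep =>
    have := (congrArg Prod.snd hstep).symm.trans hs
    simp at this
  | act hstep hact hrest =>
    have := (congrArg Prod.snd hstep).symm.trans hs
    simp only [Option.some.injEq, Prod.mk.injEq] at this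
    obtain ⟨rfl, rfl⟩ := this
    exact ⟨_, _, hact, hrest, List.subset_append_right _ _⟩

variable (T b k w) in
/-- What an outcome `ρ` above the stack `s` says about the string `v` that is written. -/
def Fulfils (s : List ℕ) (ρ : Option Q) (v : List β) : Prop :=
  (ρ = none → b ∈ v) ∧
    ∀ q₁ p₁ s', ρ = some q₁ → s = p₁ :: s' → ∃ v', T.Produces k w q₁ (p₁, s') v' ∧ v' ⊆ v

theorem Fulfils.mono {s : List ℕ} {ρ : Option Q} {v v' : List β} (h : T.Fulfils b k w s ρ v)
    (hv : v ⊆ v') : T.Fulfils b k w s ρ v' := by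
  refine ⟨fun hρ => hv (h.1 hρ), fun q₁ p₁ s' hρ hs => ?_⟩
  obtain ⟨u, hu, huv⟩ := h.2 q₁ p₁ s' hρ hs
  exact ⟨u, hu, List.Subset.trans huv hv⟩

theorem Reach.sound {sub : Q → ℕ → Option Q → Prop} {s : List ℕ}
    (hsub : ∀ q p ρ v, sub q p ρ → T.Produces k w q (0, p :: s) v → T.Fulfils b k w (p :: s) ρ v)
    {n : ℕ} {ρ : Option Q} {q : Q} {p : ℕ} (h : T.Reach b n (tapeSymbol w) sub s ρ q p)
    {v : List β} (hv : T.Produces k w q (p, s) v) : T.Fulfils b k w s ρ v := by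
  -- `Reach` is the least closed set, so it suffices that the claim itself defines a closed set.
  refine h (fun p q => ∀ v, T.Produces k w q (p, s) v → T.Fulfils b k w s ρ v) ?_ ?_ v hv
  · rintro p - q (⟨hb, rfl⟩ | ⟨q', hq', rfl⟩ | ⟨rfl, q', hq', hs⟩) v hv
    · exact ⟨fun _ => hv.subset hb, by simp⟩
    · refine ⟨by simp, ?_⟩
      rintro q₁ p₁ s' ⟨⟩ rfl
      obtain ⟨c', v', hc', hv', hsub⟩ := hv.next hq'
      simp only [PebbleAction.apply, Option.some.injEq] at hc'
      subst hc'
      exact ⟨v', hv', hsub⟩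
    · obtain ⟨c', v', hc', hv', hvv⟩ := hv.next hq'
      simp only [PebbleAction.apply] at hc'
      split_ifs at hc'
      simp only [Option.some.injEq] at hc'
      subst hc'
      exact ⟨fun _ => hvv ((hsub _ _ _ _ hs hv').1 rfl), by simp⟩
  · rintro p - p' - q q' (⟨m, hm, hr⟩ | ⟨rfl, q₁, hq₁, hs⟩) ih v hv
    · obtain ⟨c', v', hc', hv', hvv⟩ := hv.next hm
      simp only [PebbleAction.apply, Option.map_eq_some_iff] at hc'
      obtain ⟨p'', hp'', rfl⟩ := hc'
      obtain rfl := hr.unique (Move.rel_of_apply hp'')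
      exact (ih _ hv').mono hvv
    · obtain ⟨c', v', hc', hv', hvv⟩ := hv.next hq₁
      simp only [PebbleAction.apply] at hc'
      split_ifs at hc'
      simp only [Option.some.injEq] at hc'
      subst hc'
      obtain ⟨v'', hv'', hvv'⟩ := (hsub _ _ _ _ hs hv').2 q' p s rfl rfl
      exact (ih _ hv'').mono (List.Subset.trans hvv' hvv)

theorem Outcome.sound {n r : ℕ} {s : List ℕ} {ρ : Option Q} {q : Q} {p : ℕ}
    (h : T.Outcome b n (tapeSymbol w) r s ρ q p) {v : List β}
    (hv : T.Produces k w q (p, s) v) : T.Fulfils b k w s ρ v := by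
  induction r generalizing s ρ q p v with
  | zero => exact Reach.sound (by simp) h hv
  | succ r ih => exact Reach.sound (fun _ _ _ _ hs hv => ih hs hv) h hv

variable (T b k w) in
/-- The run from `(q, p)` above the stack `s` writes `b`, possibly after popping pebbles. -/
def Writes : List ℕ → Q → ℕ → Prop
  | [], q, p => T.Outcome b (w.length + 2) (tapeSymbol w) k [] none q p
  | p₁ :: s, q, p =>
    T.Outcome b (w.length + 2) (tapeSymbol w) (k - (s.length + 1)) (p₁ :: s) none q p ∨
      ∃ q₁, T.Outcome b (w.length + 2) (tapeSymbol w) (k - (s.length + 1)) (p₁ :: s) (some q₁) q p ∧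
        Writes s q₁ p₁

theorem Writes.of_outcome {s : List ℕ} {q : Q} {p : ℕ}
    (h : T.Outcome b (w.length + 2) (tapeSymbol w) (k - s.length) s none q p) :
    T.Writes b k w s q p := by
  cases s with
  | nil => exact h
  | cons p₁ s => exact Or.inl h

theorem Writes.imp {s : List ℕ} {q q' : Q} {p p' : ℕ} (h : T.Writes b k w s q p)
    (hi : ∀ ρ, T.Outcome b (w.length + 2) (tapeSymbol w) (k - s.length) s ρ q p →
      T.Outcome b (w.length + 2) (tapeSymbol w) (k - s.length) s ρ q' p') :
    T.Writes b k w s q' p' := by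
  cases s with
  | nil => exact hi none h
  | cons p₁ s =>
    rcases h with h | ⟨q₁, h, h'⟩
    · exact Or.inl (hi _ h)
    · exact Or.inr ⟨q₁, hi _ h, h'⟩

/-- Writing, moving and popping do not involve `sub`, so for them the number of remaining pebbles
need not be distinguished. -/
theorem Outcome.exists_reach (n : ℕ) (X : ℕ → TapeSymbol α) (r : ℕ) (s : List ℕ) :
    ∃ sub : Q → ℕ → Option Q → Prop, T.Outcome b n X r s = T.Reach b n X sub s := by
  cases r with
  | zero => exact ⟨_, rfl⟩
  | succ r => exact ⟨_, rfl⟩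

/-- Induction along the run from its end. A configuration inside a nested run may write `b` only
after popping, so the invariant `Writes` follows the whole stack, not just the current level. -/
theorem Writes.of_mem {q : Q} {c : ℕ × List ℕ} {v : List β} (h : T.Produces k w q c v)
    (hb : b ∈ v) (hp : c.1 < w.length + 2) (hs : ∀ x ∈ c.2, x < w.length + 2) :
    T.Writes b k w c.2 q c.1 := by
  induction h with
  | @halt q c u hstep =>
    obtain ⟨sub, hsub⟩ := Outcome.exists_reach (T := T) (b := b) (w.length + 2) (tapeSymbol w)
      (k - c.2.length) c.2
    refine Writes.of_outcome ?_
    rw [hsub]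
    exact Reach.of_immediate hp (Or.inl ⟨(congrArg Prod.fst hstep).symm ▸ hb, rfl⟩)
  | @act q q' c c' a u v hstep hact hrest ih =>
    have hstep' := congrArg Prod.snd hstep
    by_cases hu : b ∈ u
    · obtain ⟨sub, hsub⟩ := Outcome.exists_reach (T := T) (b := b) (w.length + 2) (tapeSymbol w)
        (k - c.2.length) c.2
      refine Writes.of_outcome ?_
      rw [hsub]
      exact Reach.of_immediate hp (Or.inl ⟨(congrArg Prod.fst hstep).symm ▸ hu, rfl⟩)
    have hv : b ∈ v := (List.mem_append.1 hb).resolve_left hu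
    obtain ⟨p, s⟩ := c
    cases a with
    | move m =>
      simp only [PebbleAction.apply, Option.map_eq_some_iff] at hact
      obtain ⟨p', hp', rfl⟩ := hact
      have hp'' : p' < w.length + 2 := by have := Move.le_of_apply hp' (by simp at hp; omega); omega
      refine (ih hv hp'' hs).imp fun ρ => ?_
      obtain ⟨sub, hsub⟩ := Outcome.exists_reach (T := T) (b := b) (w.length + 2) (tapeSymbol w)
        (k - s.length) s
      simp only [hsub]
      exact Reach.of_successor hp hp'' (Or.inl ⟨m, hstep', Move.rel_of_apply hp'⟩)
    | push =>
      simp only [PebbleAction.apply] at hact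
      split_ifs at hact with hk
      simp only [Option.some.injEq] at hact
      subst hact
      -- Since the push was allowed, a pebble remains, and `Outcome` unfolds to its successor case.
      -- The nested run then either writes `b`, or pops and acts as a single transition of the outer
      -- run.
      have hr : k - s.length = k - (s.length + 1) + 1 := by omega
      rcases ih hv (by simp) (by simpa using ⟨hp, hs⟩) with h | ⟨q₁, h, h'⟩
      · refine Writes.of_outcome ?_
        simp only [hr]
        exact Reach.of_immediate hp (Or.inr (Or.inr ⟨rfl, q', hstep', h⟩))
      · refine h'.imp fun ρ => ?_
        simp only [hr]
        exact Reach.of_successor hp hp (Or.inr ⟨rfl, q', hstep', h⟩)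
    | pop =>
      cases s with
      | nil => simp [PebbleAction.apply] at hact
      | cons p₁ s =>
        simp only [PebbleAction.apply, Option.some.injEq] at hact
        subst hact
        refine Or.inr ⟨q', ?_, ih hv (hs _ (by simp)) fun x hx => hs x (by simp_all)⟩
        obtain ⟨sub, hsub⟩ := Outcome.exists_reach (T := T) (b := b) (w.length + 2) (tapeSymbol w)
          (k - (s.length + 1)) (p₁ :: s)
        rw [hsub]
        exact Reach.of_immediate hp (Or.inr (Or.inl ⟨q', hstep', rfl⟩))

theorem Computes.mem_iff {f : List α → List β} (h : T.Computes k f) (w : List α) (b : β) :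
    b ∈ f w ↔ T.Outcome b (w.length + 2) (tapeSymbol w) k [] none T.start 0 :=
  ⟨fun hb => Writes.of_mem (h w) hb (by simp) (by simp), fun ho => (ho.sound (h w)).1 rfl⟩

end Correct

end PebbleTransducer

/-! ### Copy-first-half is not polyregular -/

/-- For a polyregular function, the occurrence of `b` in the output depends only on a finite amount of
information about each prefix of the tape. -/
theorem IsPolyregular.finiteIndex {α β : Type*} [Finite α] {f : List α → List β}
    (hf : IsPolyregular f) (b : β) :
    ∃ Φ : ℕ → (ℕ → TapeSymbol α) → (ℕ → ℕ) → Prop, FiniteIndex Φ ∧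
      ∀ w e, b ∈ f w ↔ Φ (w.length + 2) (tapeSymbol w) e := by
  obtain ⟨k, Q, _, T, hT⟩ := hf
  -- With an empty stack, variable `0` is the head; fixing it at position `0` makes the assignment
  -- `e` irrelevant.
  refine ⟨_, (T.finiteIndex_outcome b k 0 none T.start).update_zero 0, fun w e => ?_⟩
  simpa [stackOf] using hT.mem_iff w b

theorem IsRegular.isPolyregular {α β : Type*} {f : List α → List β} (hf : IsRegular f) :
    IsPolyregular f := by
  obtain ⟨Q, hQ, T, hT⟩ := hf
  let T' : PebbleTransducer Q α β :=
    { start := T.start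
      step := fun q V => match V.symbols with
        | [] => ([], none)
        | c :: _ => ((T.step q c).1, (T.step q c).2.map fun x => (x.1, .move x.2)) }
  refine ⟨0, Q, hQ, T', fun w => ?_⟩
  have key : ∀ q p v, T.Produces w q p v → T'.Produces 0 w q (p, []) v := by
    intro q p v h
    induction h with
    | halt hstep => exact .halt (by simp [T', pebbleView, hstep])
    | @move q q' p p' m u v hstep hmove hrest ih =>
      exact .act (a := .move m) (q' := q') (by simp [T', pebbleView, hstep])
        (by simp [PebbleAction.apply, hmove]) ih
  exact key _ _ _ (hT w)

/-- The cut comes after the left end marker and the letters of `x`; the right end marker of `x` and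
the left one of `z` are dropped. -/
theorem tapeSymbol_append {α : Type*} (x z : List α) :
    tapeSymbol (x ++ z) = glue (x.length + 1) (tapeSymbol x) fun i => tapeSymbol z (i + 1) := by
  funext i
  unfold glue
  cases i with
  | zero => simp [tapeSymbol]
  | succ i =>
    by_cases h : i < x.length
    · simp [tapeSymbol, h, List.getElem?_append_left]
    · have h1 : ¬ (i + 1 < x.length + 1) := by omega
      have h2 : i + 1 - (x.length + 1) = i - x.length := by omega
      simp only [h1, if_false, h2]
      simp [tapeSymbol, List.getElem?_append_right (Nat.le_of_not_lt h)]

theorem mem_copyFirstHalf_iff {α : Type*} {a b : α} (hab : a ≠ b) (m p : ℕ) :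
    b ∈ copyFirstHalf (List.replicate m a ++ b :: List.replicate p a) ↔ m + 1 ≤ p := by
  have hl : (List.replicate m a ++ b :: List.replicate p a).length / 2 = (m + (p + 1)) / 2 := by simp
  rw [copyFirstHalf, hl, List.take_append, List.length_replicate]
  -- This difference is the number of symbols taken from `b` onwards; `b` survives iff it is
  -- positive.
  rcases h : (m + (p + 1)) / 2 - m with _ | j
  · simp [hab.symm, List.take_replicate]
    omega
  · simp
    omega

theorem not_isPolyregular_copyFirstHalf {α : Type*} [Finite α] [Nontrivial α] :
    ¬ IsPolyregular (copyFirstHalf (α := α)) := by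
  intro hf
  obtain ⟨a, b, hab⟩ := exists_pair_ne α
  obtain ⟨Φ, ⟨S, hS, τ, hτ⟩, hΦ⟩ := hf.finiteIndex b
  -- Pigeonhole: two prefixes `a^m` and `a^m'`, with the left end marker, have the same type.
  obtain ⟨m, m', hne, ht⟩ := Finite.exists_ne_map_eq_of_infinite fun m : ℕ =>
    τ (m + 1) (tapeSymbol (List.replicate m a)) fun _ => none
  have key : ∀ p, m + 1 ≤ p ↔ m' + 1 ≤ p := by
    intro p
    -- The suffix has `p + 2` cells: `b`, the `p` copies of `a`, and the right end marker.
    have h := hτ _ _ _ _ _ _ (by simp) (by simp) ht (p + 2)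
      (fun i => tapeSymbol (b :: List.replicate p a) (i + 1)) fun _ => 0
    have hm (m : ℕ) := hΦ (List.replicate m a ++ b :: List.replicate p a)
      (joinAssign (m + 1) (fun _ => none) fun _ => 0)
    simp only [mem_copyFirstHalf_iff hab, tapeSymbol_append, List.length_append,
      List.length_replicate, List.length_cons] at hm
    have hlen (m : ℕ) : m + (p + 1) + 2 = m + 1 + (p + 2) := by omega
    rw [hm m, hm m', hlen m, hlen m', h]
  have h1 := key (m + 1)
  have h2 := key (m' + 1)
  omega

end Transduction

/-! ### The B-RASP[pos] program -/

namespace BRASP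

theorem flatten_ofFn_take {α : Type*} (w : List α) (m : ℕ) :
    (List.ofFn fun i : Fin w.length => if (i : ℕ) < m then [w.get i] else []).flatten =
      w.take m := by
  induction w generalizing m with
  | nil => simp
  | cons a w ih =>
    cases m with
    | zero => simp
    | succ m =>
      simp only [List.length_cons, List.ofFn_succ, List.flatten_cons]
      have := ih m
      simp_all

/-- The symbol `g a` for the first `a` in `l` such that `in(i) = f a`, and `d` if there is none. -/
def translate {α : Type*} {Δ : Type} {Γ : List Ty} (f g : α → Δ) (x : VecName Γ .char) (d : Δ) :
    List α → Exp Δ Γ Unit .char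
  | [] => .symbol d
  | a :: l => .ite (.charEq (.charVec x ()) (.symbol (f a))) (.symbol (g a))
      (translate f g x d l)

/-- By injectivity of `f`, no test for a letter other than `a` succeeds. -/
theorem translate_eval {α : Type*} {Δ : Type} {Γ : List Ty} {n : ℕ} (env : Env Δ n Γ)
    (ρ : Unit → Fin n) {f g : α → Δ} (hf : Function.Injective f) (x : VecName Γ .char) (d : Δ)
    {l : List α} {a : α} (ha : a ∈ l) (hx : env .char x (ρ ()) = f a) :
    (translate f g x d l).eval env ρ = g a := by
  induction l with
  | nil => simp at ha
  | cons b l ih =>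
    by_cases hab : a = b
    · subst hab
      simp [translate, Exp.eval, hx]
    · have : f a ≠ f b := fun h => hab (hf h)
      simp only [List.mem_cons, hab, false_or] at ha
      simpa [translate, Exp.eval, hx, this] using ih ha

/-- The definition of the vector with all entries `n - 1`. -/
def lastPosition (Δ : Type) : Rhs Δ [.char, .nat] .nat :=
  .attention .rightmost .none (.bool .tt) (.nat () (.vec (.prev .last))) (.nat () .zero)

theorem lastPosition_eval {Δ : Type} {n : ℕ} (input : Fin n → Δ) (i : Fin n) :
    (lastPosition Δ).eval (initialEnv input) i = n - 1 := by
  have hall : ∀ j, j ∈ attended (initialEnv input) Mask.none (AttnPred.bool .tt) i := by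
    intro j
    simp [attended, Mask.Holds, AttnPred.Holds, Exp.eval]
  have hne : (attended (initialEnv input) Mask.none (AttnPred.bool .tt) i).Nonempty := ⟨i, hall i⟩
  have hmax := Finset.le_max' _ _ (hall ⟨n - 1, by have := i.isLt; omega⟩)
  simp only [lastPosition, Rhs.eval, hne, dite_true]
  change ((Finset.max' _ hne : Fin n) : ℕ) = n - 1
  have hlt := (Finset.max' _ hne).isLt
  have := Fin.le_def.1 hmax
  simp only at this
  omega

/-- The program for copy-first-half: the packed input symbol where `2 i < n - 1`, the packed empty
string elsewhere. -/
def firstHalfProgram {α : Type*} {Δ : Type} (f g : α → Δ) (d : Δ) (l : List α) :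
    Program Δ [.char, .nat] :=
  .define (lastPosition Δ) <|
  .define (t := .char) (.pointwise (.ite
    (.cmp () .lt (.add (.vec (.prev (.prev .last))) (.vec (.prev (.prev .last)))) (.vec .last))
    (translate f g (.prev .last) d l) (.symbol d))) <|
  .out .last

theorem firstHalfProgram_eval {α : Type*} {Δ : Type} {f g : α → Δ} (hf : Function.Injective f)
    (d : Δ) {l : List α} (hl : ∀ a, a ∈ l) {n : ℕ} (w : Fin n → α) (i : Fin n) :
    (firstHalfProgram f g d l).eval (initialEnv fun i => f (w i)) i =
      if (i : ℕ) < n / 2 then g (w i) else d := by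
  have hi := i.isLt
  set env : Env Δ n [.nat, .char, .nat] :=
    Env.cons (s := .nat) ((lastPosition Δ).eval (initialEnv fun i => f (w i)))
      (initialEnv fun i => f (w i)) with henv
  have hlast : env .nat .last i = n - 1 := lastPosition_eval _ i
  have htr := translate_eval (g := g) env (fun _ => i) hf (.prev .last) d (hl (w i)) rfl
  -- A sum clipped to `n - 1` fails the strict test, just as the unclipped sum does; and `2 i < n -
  -- 1` means `2 (i + 1) ≤ n`.
  have hcmp : decide (min ((i : ℕ) + i) (n - 1) < env .nat .last i) = decide ((i : ℕ) < n / 2) := by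
    rw [hlast, decide_eq_decide]
    omega
  change cond (decide (min ((i : ℕ) + i) (n - 1) < env .nat .last i))
    ((translate f g (.prev .last) d l).eval env fun _ => i) d = _
  rw [hcmp, htr]
  by_cases h : (i : ℕ) < n / 2 <;> simp [h]

theorem computable_copyFirstHalf {α : Type*} [Finite α] :
    Computable (Transduction.copyFirstHalf (α := α)) := by
  have : Finite (Packed α 1) := (List.finite_length_le α 1).to_subtype
  -- The symbols are the disjoint union of input letters and packed strings, moved to `Fin N`
  -- because `Δ` must be in `Type`.
  obtain ⟨N, ⟨eq⟩⟩ := Finite.exists_equiv_fin (α ⊕ Packed α 1)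
  cases nonempty_fintype α
  let inSym : α ↪ Fin N := Function.Embedding.inl.trans eq.toEmbedding
  let outSym : Packed α 1 ↪ Fin N := Function.Embedding.inr.trans eq.toEmbedding
  refine ⟨1, Fin N, inferInstance, inSym, outSym,
    firstHalfProgram inSym (fun a => outSym ⟨[a], by simp⟩) (outSym ⟨[], by simp⟩)
      Finset.univ.toList, fun w => ?_⟩
  refine ⟨fun i => if (i : ℕ) < w.length / 2 then ⟨[w.get i], by simp⟩ else ⟨[], by simp⟩, ?_, ?_⟩
  · funext i
    rw [firstHalfProgram_eval inSym.injective _ (by simp)]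
    split_ifs with h <;> simp [h]
  · rw [Transduction.copyFirstHalf, ← flatten_ofFn_take]
    congr 2
    funext i
    split_ifs with h <;> simp [h]

end BRASP

/-- For every finite alphabet `α`, B-RASP[pos] with packed outputs computes copy-first-half, and
if `α` has at least two letters, copy-first-half is neither regular nor polyregular. -/
theorem mainTheorem7 {α : Type*} [Finite α] :
    BRASP.Computable (Transduction.copyFirstHalf (α := α)) ∧
      (Nontrivial α →
        ¬ Transduction.IsRegular (Transduction.copyFirstHalf (α := α)) ∧
          ¬ Transduction.IsPolyregular (Transduction.copyFirstHalf (α := α))) := by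
  exact ⟨BRASP.computable_copyFirstHalf, fun _ =>
    ⟨fun h => Transduction.not_isPolyregular_copyFirstHalf h.isPolyregular,
      Transduction.not_isPolyregular_copyFirstHalf⟩⟩
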